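/- All graphs are finite and simple; $e(H)$ and $v(H)$ denote the numbers of edges and vertices of $H$. A graph is $K_q$-divisible if $\binom q2$ divides its number of edges and $q-1$ divides each of its degrees. A $K_q$-decomposition of a graph is a collection of pairwise edge-disjoint copies of $K_q$ in it whose edge sets partition its edge set. A $K_q$-absorber for a $K_q$-divisible graph $L$ is a graph $A$ such that $V(L)\subseteq V(A)$ is independent in $A$ and both $A$ and $L\cup A$ admit $K_q$-decompositions. For a graph $H$ and an independent set $R\subseteq V(H)$ of $H$, let $$m(H,R)=\max\left\{\frac{e(H')}{|V(H')\setminus R|}: H'\subseteq H,\ V(H')\setminus R\neq\emptyset\right\},\qquad m_2(H)=\max\left\{\frac{e(H')-1}{v(H')-2}: H'\subseteq H,\ v(H')\ge 3\right\},$$ where $\max\emptyset=-\infty$, and let $m_2(H,R)=\max\{m(H,R),m_2(H)\}$. Let $d_{\rm abs}(K_q)$ be the infimum of all positive reals $r$ such that for every positive integer $C_1$ there is a positive integer $C_2$ such that every $K_q$-divisible graph $L$ on at most $C_1$ vertices has a $K_q$-absorber $A$ on at most $C_2$ vertices with $m_2(A,V(L))\le r$ (with $\inf\emptyset=+\infty$).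 **Theorem.** $d_{\rm abs}(K_3)\le 3$. Equivalently, for every $\varepsilon>0$ and every positive integer $C_1$ there is a positive integer $C_2$ such that every $K_3$-divisible graph $L$ on at most $C_1$ vertices has a $K_3$-absorber $A$ on at most $C_2$ vertices with $m_2(A,V(L))\le 3+\varepsilon$. -/

import Mathlib

namespace TriangleAbsorber

/-- A `K_q`-decomposition of `G`, given by the vertex sets of its copies of `K_q`: every member of
`𝒬` is a `q`-clique of `G`, and every edge of `G` lies in exactly one member of `𝒬`. -/
def IsCliqueDecomposition {V : Type*} (q : ℕ) (G : SimpleGraph V) (𝒬 : Set (Finset V)) : Prop :=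
  (∀ Q ∈ 𝒬, G.IsNClique q Q) ∧
    ∀ u v : V, G.Adj u v → ∃! Q : Finset V, Q ∈ 𝒬 ∧ u ∈ Q ∧ v ∈ Q

/-- `G` admits a `K_q`-decomposition. -/
def HasCliqueDecomposition {V : Type*} (q : ℕ) (G : SimpleGraph V) : Prop :=
  ∃ 𝒬 : Set (Finset V), IsCliqueDecomposition q G 𝒬

/-- `G` is `K_q`-divisible: `q.choose 2` divides the number of edges and `q - 1` divides every
degree (used for finite graphs only). -/
def IsCliqueDivisible {V : Type*} (q : ℕ) (G : SimpleGraph V) : Prop :=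
  q.choose 2 ∣ G.edgeSet.ncard ∧ ∀ v : V, (q - 1) ∣ (G.neighborSet v).ncard

/-- `A` is a `K_q`-absorber for `L`, where the embedding `f` identifies `V(L)` with a subset of
`V(A)`: the set `V(L)` is independent in `A`, and both `A` and `L ∪ A` admit
`K_q`-decompositions. -/
def IsAbsorber {V W : Type*} (q : ℕ) (L : SimpleGraph V) (f : V ↪ W) (A : SimpleGraph W) : Prop :=
  A.IsIndepSet (Set.range f) ∧ HasCliqueDecomposition q A ∧
    HasCliqueDecomposition q (L.map f ⊔ A)

/-- The maximum rooted density `m(H, R)`: the maximum of `e(H') / |V(H') \ R|` over the subgraphs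
`H'` of the finite graph `H` having a vertex outside `R` (with the value `-∞` if there are none). -/
noncomputable def maxRootedDensity {W : Type*} (H : SimpleGraph W) (R : Set W) : EReal :=
  ⨆ (H' : H.Subgraph) (_ : (H'.verts \ R).Nonempty),
    (((H'.edgeSet.ncard : ℝ) / ((H'.verts \ R).ncard : ℝ) : ℝ) : EReal)

/-- The maximum `2`-density `m₂(H)`: the maximum of `(e(H') - 1) / (v(H') - 2)` over the subgraphs
`H'` of the finite graph `H` having at least three vertices (with the value `-∞` if there are
none). -/
noncomputable def maxTwoDensity {W : Type*} (H : SimpleGraph W) : EReal :=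
  ⨆ (H' : H.Subgraph) (_ : 3 ≤ H'.verts.ncard),
    ((((H'.edgeSet.ncard : ℝ) - 1) / ((H'.verts.ncard : ℝ) - 2) : ℝ) : EReal)

/-- The maximum rooted `2`-density `m₂(H, R) = max {m(H, R), m₂(H)}`. -/
noncomputable def maxRootedTwoDensity {W : Type*} (H : SimpleGraph W) (R : Set W) : EReal :=
  max (maxRootedDensity H R) (maxTwoDensity H)

/-- `r` is achievable: for every `C₁` there is `C₂` such that every `K_q`-divisible graph `L` on at
most `C₁` vertices has a `K_q`-absorber `A` on at most `C₂` vertices with `m₂(A, V(L)) ≤ r`. -/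
def IsAchievable (q : ℕ) (r : ℝ) : Prop :=
  ∀ C₁ : ℕ, 0 < C₁ → ∃ C₂ : ℕ, 0 < C₂ ∧
    ∀ (V : Type) [Finite V] (L : SimpleGraph V), Nat.card V ≤ C₁ → IsCliqueDivisible q L →
      ∃ (W : Type) (_ : Finite W) (f : V ↪ W) (A : SimpleGraph W),
        Nat.card W ≤ C₂ ∧ IsAbsorber q L f A ∧
          maxRootedTwoDensity A (Set.range f) ≤ (r : EReal)

/-- The `K_q`-absorber rooted `2`-density threshold `d_abs(K_q)`: the infimum of all achievable
positive reals, taken in the extended reals (so it is `+∞` if no positive real is achievable). -/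
noncomputable def dAbs (q : ℕ) : EReal :=
  ⨅ (r : ℝ) (_ : 0 < r ∧ IsAchievable q r), (r : EReal)

end TriangleAbsorber

/-! Place V(L) on the private vertices of a chain of triangles. The union of L and the chain is
connected, with even degrees and 3k edges, so it is a closed Euler trail φ of length 3k.

Let φ and ψ be closed trails of equal length, one of them injective, and join each ψ j to φ j and φ
(j + 1). These cross edges split into triangles both with the edges of φ and with those of ψ, so an
absorber of ψ extends to one of φ (`hasCliqueDecomposition_layer`). Pass from φ to a 3k-cycle, then
through M further 3k-cycles, and finally to an Euler trail of a chain of k triangles, which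
decomposes itself. With the triangles of the outer chain added, this absorbs L.

For the rooted density, edges are charged to vertices. Roots may pay nothing, so the outermost cycle
pays for its cross edges towards φ; at the innermost chain the last cycle pays for the cross edges
inwards. Between consecutive cycles a vertex has at most two cross edges on either side, so their
cost can be split in any proportion. Moving the proportion by 1/M per layer keeps every charge at
most 3 + ε with ε = 2/M (`exists_cycle_absorber`). The 2-density follows from this charging together
with e(S) ≤ 3|S| - 5, valid for |S| ≥ 2 in the outer chain and in the cycle part. -/

namespace TriangleAbsorber

open SimpleGraph Finset

/-! ### Eulerian trails -/

section Euler

variable {V : Type*}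

/-- A trail of maximal length uses every edge at its end. -/
theorem mem_edges_of_longest_trail {G : SimpleGraph V} {u w : V} {p : G.Walk u w}
    (hp : p.IsTrail)
    (hmax : ∀ (u' v' : V) (p' : G.Walk u' v') (_ : p'.IsTrail), p'.length ≤ p.length)
    {x : V} (hx : G.Adj w x) : s(w, x) ∈ p.edges := by
  by_contra h
  have h2 : (p.concat hx).IsTrail := by
    rw [Walk.isTrail_def, Walk.edges_concat, List.concat_eq_append]
    exact List.nodup_append.2 ⟨hp.edges_nodup, by simp, by
      intro a ha b hb hab
      simp only [List.mem_singleton] at hb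
      exact h (hb ▸ hab ▸ ha)⟩
  have := hmax _ _ _ h2
  simp at this

/-- **Euler's theorem**: a finite connected graph with even degrees has a closed Eulerian trail. -/
theorem exists_isEulerian [Finite V] [DecidableEq V] {G : SimpleGraph V} (hG : G.Connected)
    (hev : ∀ v, Even (G.neighborSet v).ncard) : ∃ (u : V) (p : G.Walk u u), p.IsEulerian := by
  classical
  have := Fintype.ofFinite V
  have := hG.nonempty
  obtain ⟨u, w, p, hp, hmax⟩ := Walk.exists_isTrail_forall_isTrail_length_le_length G
  have huw : u = w := by
    by_contra hne
    have h1 := hp.even_countP_edges_iff w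
    -- By maximality every edge at the end `w` lies on the trail. If the trail were open, their
    -- number would be odd, against the even degree.
    have h2 : p.edges.countP (fun e => w ∈ e) = G.degree w := by
      rw [← card_incidenceFinset_eq_degree, List.countP_eq_length_filter,
        ← List.toFinset_card_of_nodup (hp.edges_nodup.filter _)]
      congr 1
      ext e
      simp only [List.mem_toFinset, List.mem_filter, decide_eq_true_eq, mem_incidenceFinset,
        incidenceSet, Set.mem_ofPred_eq]
      refine ⟨fun h => ⟨p.edges_subset_edgeSet h.1, h.2⟩, fun h => ⟨?_, h.2⟩⟩
      obtain ⟨x, rfl⟩ := Sym2.mem_iff_exists.1 h.2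
      exact mem_edges_of_longest_trail hp hmax h.1
    have h3 : Even (G.degree w) := by
      have := hev w
      rwa [Set.ncard_eq_toFinset_card', ← neighborFinset_def] at this
    rw [h2] at h1
    exact (h1.1 h3 hne).2 rfl
  subst huw
  -- Rotating the closed trail makes `x` its end without changing the length, so maximality applies
  -- at every vertex of the trail.
  have hall : ∀ x ∈ p.support, ∀ y, G.Adj x y → s(x, y) ∈ p.edges := by
    intro x hx y hxy
    have h1 : (p.rotate x hx).IsTrail := (Walk.isTrail_rotate hx).2 hp
    have h2 := mem_edges_of_longest_trail h1 (by simpa using hmax) hxy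
    exact (p.rotate_edges x hx).perm.mem_iff.1 h2
  have hsupp : ∀ x, x ∈ p.support := by
    intro x
    obtain ⟨q⟩ := hG.preconnected u x
    have : ∀ (a b : V) (q : G.Walk a b), a ∈ p.support → b ∈ p.support := by
      intro a b q
      induction q with
      | nil => exact id
      | cons h q ih => exact fun ha => ih (p.snd_mem_support_of_mem_edges (hall _ ha _ h))
    exact this u x q p.start_mem_support
  refine ⟨u, p, hp.isEulerian_of_forall_mem fun e => ?_⟩
  induction e using Sym2.ind with
  | _ x y => exact fun he => hall x (hsupp x) y he

end Euler

/-! ### Closed trails indexed by `ZMod ℓ` -/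

section ClosedTrail

variable {X : Type*} {ℓ : ℕ}

/-- The edges of the closed walk `φ` are not loops and are traversed once. -/
def IsClosedTrail (φ : ZMod ℓ → X) : Prop :=
  (∀ j, φ j ≠ φ (j + 1)) ∧ Function.Injective fun j => s(φ j, φ (j + 1))

/-- The graph formed by the edges of the closed walk `φ`. -/
def trailGraph (φ : ZMod ℓ → X) : SimpleGraph X where
  Adj u v := u ≠ v ∧ ∃ j, s(φ j, φ (j + 1)) = s(u, v)
  symm := ⟨fun u v h => ⟨h.1.symm, by rw [Sym2.eq_swap]; exact h.2⟩⟩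
  loopless := ⟨fun _ h => h.1 rfl⟩

/-- A connected graph with even degrees is the graph of a closed trail. -/
theorem exists_closedTrail [Finite X] {G : SimpleGraph X} (hG : G.Connected)
    (hev : ∀ v, Even (G.neighborSet v).ncard) (hℓ : G.edgeSet.ncard = ℓ) (h0 : ℓ ≠ 0) :
    ∃ φ : ZMod ℓ → X, IsClosedTrail φ ∧ trailGraph φ = G := by
  classical
  have := Fintype.ofFinite X
  have : NeZero ℓ := ⟨h0⟩
  obtain ⟨u, p, hp⟩ := exists_isEulerian hG hev
  have hlen : p.length = ℓ := by
    rw [← hℓ, Set.ncard_eq_toFinset_card', ← edgeFinset, ← hp.edgesFinset_eq]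
    exact p.length_edges.symm
  -- The wrap-around index is harmless because the walk is closed: its vertices number `ℓ` and 0
  -- coincide.
  have hnext : ∀ j : ZMod ℓ, p.getVert (j + 1).val = p.getVert (j.val + 1) := by
    intro j
    rw [ZMod.val_add, ZMod.val_one_eq_one_mod, Nat.add_mod_mod]
    rcases Nat.lt_or_ge (j.val + 1) ℓ with h | h
    · rw [Nat.mod_eq_of_lt h]
    · have : j.val + 1 = ℓ := le_antisymm (ZMod.val_lt j) h
      rw [this, Nat.mod_self, ← hlen, Walk.getVert_length, Walk.getVert_zero]
  have hedge : ∀ j : ZMod ℓ, ∃ h : j.val < p.edges.length,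
      s(p.getVert j.val, p.getVert (j + 1).val) = p.edges[j.val] := by
    intro j
    have : j.val < p.edges.length := by rw [Walk.length_edges, hlen]; exact ZMod.val_lt j
    exact ⟨this, by rw [hnext, Walk.getElem_edges]⟩
  refine ⟨fun j => p.getVert j.val, ⟨fun j => ?_, fun i j hij => ?_⟩, ?_⟩
  · simp only [hnext]
    exact (p.adj_getVert_succ (by rw [hlen]; exact ZMod.val_lt j)).ne
  · obtain ⟨hi, h1⟩ := hedge i
    obtain ⟨hj, h2⟩ := hedge j
    simp only at hij
    rw [h1, h2] at hij
    exact ZMod.val_injective ℓ ((hp.isTrail.edges_nodup.getElem_inj_iff).1 hij)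
  · ext x y
    constructor
    · rintro ⟨-, j, hj⟩
      obtain ⟨h, h1⟩ := hedge j
      have : s(x, y) ∈ p.edges := by
        rw [← hj, h1]; exact List.getElem_mem h
      exact p.adj_of_mem_edges this
    · intro h
      refine ⟨h.ne, ?_⟩
      obtain ⟨i, hi, h2⟩ := (p.mk_mem_edges_iff_exists).1 (hp.mem_edges_iff.2 h)
      refine ⟨(i : ZMod ℓ), ?_⟩
      rw [← h2]
      simp only
      rw [hnext, ZMod.val_cast_of_lt (by omega)]

/-- The cycle `0, 1, …, ℓ - 1` is a closed trail. -/
theorem isClosedTrail_id (h : 3 ≤ ℓ) : IsClosedTrail (id : ZMod ℓ → ZMod ℓ) := by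
  have h1 : (1 : ZMod ℓ) ≠ 0 := by
    have : Fact (1 < ℓ) := ⟨by omega⟩
    exact one_ne_zero
  have h2 : (2 : ZMod ℓ) ≠ 0 := by
    intro h0
    have := (ZMod.natCast_eq_zero_iff 2 ℓ).1 (by exact_mod_cast h0)
    exact absurd (Nat.le_of_dvd (by norm_num) this) (by omega)
  refine ⟨fun j hj => h1 ?_, fun i j hij => ?_⟩
  · simpa using hj.symm
  · simp only [id, Sym2.eq_iff] at hij
    rcases hij with h | ⟨h3, h4⟩
    · exact h.1
    · exfalso
      apply h2
      have : j + 1 + 1 = j := by rw [← h3, h4]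
      linear_combination this

end ClosedTrail

/-! ### Triangle decompositions -/

section Decomposition

variable {V W : Type*}

/-- A family of triples pairwise sharing at most one vertex decomposes the graph it covers. -/
theorem IsCliqueDecomposition.of_triples {ι : Type*} {G : SimpleGraph V} (t : ι → Finset V)
    (ht : ∀ i, (t i).card = 3)
    (huniq : ∀ i j u v, u ≠ v → u ∈ t i → v ∈ t i → u ∈ t j → v ∈ t j → i = j)
    (hadj : ∀ u v, G.Adj u v ↔ u ≠ v ∧ ∃ i, u ∈ t i ∧ v ∈ t i) :
    IsCliqueDecomposition 3 G (Set.range t) := by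
  refine ⟨?_, fun u v huv => ?_⟩
  · rintro _ ⟨i, rfl⟩
    exact ⟨fun u hu v hv huv => (hadj u v).2 ⟨huv, i, hu, hv⟩, ht i⟩
  · obtain ⟨hne, i, hu, hv⟩ := (hadj u v).1 huv
    refine ⟨t i, ⟨⟨i, rfl⟩, hu, hv⟩, ?_⟩
    rintro _ ⟨⟨j, rfl⟩, hu', hv'⟩
    rw [huniq i j u v hne hu hv hu' hv']

theorem HasCliqueDecomposition.sup {q : ℕ} {G H : SimpleGraph V}
    (hG : HasCliqueDecomposition q G) (hH : HasCliqueDecomposition q H)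
    (hd : ∀ u v, G.Adj u v → ¬ H.Adj u v) : HasCliqueDecomposition q (G ⊔ H) := by
  obtain ⟨P, hP1, hP2⟩ := hG
  obtain ⟨Q, hQ1, hQ2⟩ := hH
  refine ⟨P ∪ Q, ?_, ?_⟩
  · rintro T (hT | hT)
    · exact (hP1 T hT).mono le_sup_left
    · exact (hQ1 T hT).mono le_sup_right
  · rintro u v (h | h)
    · obtain ⟨T, ⟨hT, hu, hv⟩, hu'⟩ := hP2 u v h
      refine ⟨T, ⟨Or.inl hT, hu, hv⟩, ?_⟩
      rintro T' ⟨hT' | hT', h1, h2⟩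
      · exact hu' T' ⟨hT', h1, h2⟩
      · exact absurd ((hQ1 T' hT').isClique h1 h2 h.ne) (hd u v h)
    · obtain ⟨T, ⟨hT, hu, hv⟩, hu'⟩ := hQ2 u v h
      refine ⟨T, ⟨Or.inr hT, hu, hv⟩, ?_⟩
      rintro T' ⟨hT' | hT', h1, h2⟩
      · exact absurd h (hd u v ((hP1 T' hT').isClique h1 h2 h.ne))
      · exact hu' T' ⟨hT', h1, h2⟩

theorem HasCliqueDecomposition.map {q : ℕ} {G : SimpleGraph V} (hG : HasCliqueDecomposition q G)
    (f : V ↪ W) : HasCliqueDecomposition q (G.map f) := by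
  obtain ⟨P, hP1, hP2⟩ := hG
  refine ⟨(Finset.map f) '' P, ?_, ?_⟩
  · rintro _ ⟨T, hT, rfl⟩
    exact (hP1 T hT).map
  · rintro _ _ ⟨hne, u, v, h, rfl, rfl⟩
    obtain ⟨T, ⟨hT, hu, hv⟩, hu'⟩ := hP2 u v h
    refine ⟨T.map f, ⟨⟨T, hT, rfl⟩, by simpa using hu, by simpa using hv⟩, ?_⟩
    rintro _ ⟨⟨T', hT', rfl⟩, h1, h2⟩
    rw [hu' T' ⟨hT', by simpa using h1, by simpa using h2⟩]

theorem hasCliqueDecomposition_bot (q : ℕ) : HasCliqueDecomposition q (⊥ : SimpleGraph V) :=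
  ⟨∅, by simp [IsCliqueDecomposition]⟩

/-- The triangles at `v`, with `v` removed, partition its neighbourhood. This yields the even
degrees of the chain. -/
theorem IsCliqueDecomposition.ncard_neighborSet [Finite V] {G : SimpleGraph V}
    {P : Set (Finset V)} (h : IsCliqueDecomposition 3 G P) (v : V) :
    (G.neighborSet v).ncard = 2 * {Q ∈ P | v ∈ Q}.ncard := by
  classical
  have := Fintype.ofFinite V
  have h1 : (G.neighborSet v).toFinset =
      {Q ∈ P | v ∈ Q}.toFinset.biUnion fun Q => Q.erase v := by
    ext u
    simp only [Set.mem_toFinset, mem_neighborSet, mem_biUnion, Set.mem_ofPred_eq, mem_erase]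
    constructor
    · intro hu
      obtain ⟨Q, ⟨hQ, h1, h2⟩, -⟩ := h.2 v u hu
      exact ⟨Q, ⟨hQ, h1⟩, hu.ne', h2⟩
    · rintro ⟨Q, ⟨hQ, h1⟩, hne, h2⟩
      exact (h.1 Q hQ).isClique h1 h2 hne.symm
  rw [Set.ncard_eq_toFinset_card', Set.ncard_eq_toFinset_card', h1, card_biUnion]
  · rw [mul_comm]
    apply sum_const_nat
    intro Q hQ
    simp only [Set.mem_toFinset, Set.mem_ofPred_eq] at hQ
    rw [card_erase_of_mem hQ.2, (h.1 Q hQ.1).card_eq]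
  · intro Q hQ Q' hQ' hne
    simp only [Set.coe_toFinset, Set.mem_ofPred_eq] at hQ hQ'
    refine Finset.disjoint_left.2 fun u hu hu' => hne ?_
    simp only [mem_erase] at hu hu'
    have hadj := (h.1 Q hQ.1).isClique hQ.2 hu.2 hu.1.symm
    exact (h.2 v u hadj).unique ⟨hQ.1, hQ.2, hu.2⟩ ⟨hQ'.1, hQ'.2, hu'.2⟩

theorem IsCliqueDecomposition.ncard_edgeSet [Finite V] {G : SimpleGraph V}
    {P : Set (Finset V)} (h : IsCliqueDecomposition 3 G P) :
    G.edgeSet.ncard = 3 * P.ncard := by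
  classical
  have := Fintype.ofFinite V
  have h1 := G.sum_degrees_eq_twice_card_edges
  have h2 : ∀ v, G.degree v = 2 * (P.toFinset.filter (v ∈ ·)).card := by
    intro v
    have := h.ncard_neighborSet v
    rw [Set.ncard_eq_toFinset_card', ← neighborFinset_def, card_neighborFinset_eq_degree] at this
    rw [this, Set.ncard_eq_toFinset_card']
    congr 2
    ext Q
    simp
  have h3 : ∑ v : V, (P.toFinset.filter (v ∈ ·)).card = 3 * P.toFinset.card := by
    have := sum_card_bipartiteAbove_eq_sum_card_bipartiteBelow (s := (univ : Finset V))
      (t := P.toFinset) (fun v Q => v ∈ Q)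
    simp only [bipartiteAbove, bipartiteBelow] at this
    rw [this, mul_comm]
    apply sum_const_nat
    intro Q hQ
    simp only [Set.mem_toFinset] at hQ
    simpa using (h.1 Q hQ).card_eq
  rw [sum_congr rfl fun v _ => h2 v, ← mul_sum, h3] at h1
  rw [Set.ncard_eq_toFinset_card', Set.ncard_eq_toFinset_card', ← edgeFinset]
  omega

end Decomposition

/-! ### Exchanging one closed trail for another -/

section Glue

variable {X Y : Type*}

/-- The graph on the disjoint union of `X` and `Y` formed by `G` on `X`, `H` on `Y` and the bipartite
graph of the relation `C`. -/
def glue (G : SimpleGraph X) (C : X → Y → Prop) (H : SimpleGraph Y) : SimpleGraph (X ⊕ Y) where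
  Adj
    | .inl x, .inl x' => G.Adj x x'
    | .inl x, .inr y => C x y
    | .inr y, .inl x => C x y
    | .inr y, .inr y' => H.Adj y y'
  symm := ⟨by
    rintro (x | y) (x' | y') h
    exacts [G.adj_symm h, h, h, H.adj_symm h]⟩
  loopless := ⟨by
    rintro (x | y) h
    exacts [G.loopless.irrefl _ h, H.loopless.irrefl _ h]⟩

variable {G G' : SimpleGraph X} {C C' : X → Y → Prop} {H H' : SimpleGraph Y}

@[simp] theorem glue_inl_inl {x x' : X} : (glue G C H).Adj (.inl x) (.inl x') ↔ G.Adj x x' :=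
  Iff.rfl

@[simp] theorem glue_inl_inr {x : X} {y : Y} : (glue G C H).Adj (.inl x) (.inr y) ↔ C x y :=
  Iff.rfl

@[simp] theorem glue_inr_inl {x : X} {y : Y} : (glue G C H).Adj (.inr y) (.inl x) ↔ C x y :=
  Iff.rfl

@[simp] theorem glue_inr_inr {y y' : Y} : (glue G C H).Adj (.inr y) (.inr y') ↔ H.Adj y y' :=
  Iff.rfl

theorem HasCliqueDecomposition.glue_right {q : ℕ} (h : HasCliqueDecomposition q (glue G C H))
    (h' : HasCliqueDecomposition q H') (hd : ∀ u v, H.Adj u v → ¬ H'.Adj u v) :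
    HasCliqueDecomposition q (glue G C (H ⊔ H')) := by
  have : glue G C (H ⊔ H') = glue G C H ⊔ H'.map Function.Embedding.inr := by
    ext (x | y) (x' | y') <;> simp
  rw [this]
  refine h.sup (h'.map _) ?_
  rintro (x | y) (x' | y') <;> simp
  exact hd y y'

theorem HasCliqueDecomposition.glue_left {q : ℕ} (h : HasCliqueDecomposition q (glue G C H))
    (h' : HasCliqueDecomposition q G') (hd : ∀ u v, G.Adj u v → ¬ G'.Adj u v) :
    HasCliqueDecomposition q (glue (G ⊔ G') C H) := by
  have : glue (G ⊔ G') C H = glue G C H ⊔ G'.map Function.Embedding.inl := by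
    ext (x | y) (x' | y') <;> simp
  rw [this]
  refine h.sup (h'.map _) ?_
  rintro (x | y) (x' | y') <;> simp
  exact hd x x'

variable {ℓ : ℕ}

/-- The vertex `ψ j` is joined to both ends of the `j`-th edge of the closed walk `φ`. -/
def cross (φ : ZMod ℓ → X) (ψ : ZMod ℓ → Y) (x : X) (y : Y) : Prop :=
  ∃ j, ψ j = y ∧ (x = φ j ∨ x = φ (j + 1))

/-- Two triangles of a layer with the same apex share no further vertex. If `β` is injective,
distinct indices with a common `β`-vertex are consecutive, and then `α i = α j` would be a loop of
`α`. -/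
theorem eq_of_common_incidence {α : ZMod ℓ → X} {β : ZMod ℓ → Y} (hα : ∀ j, α j ≠ α (j + 1))
    (h : Function.Injective α ∨ Function.Injective β) {i j : ZMod ℓ} (hij : α i = α j) {y : Y}
    (hi : y = β i ∨ y = β (i + 1)) (hj : y = β j ∨ y = β (j + 1)) : i = j := by
  rcases h with h | h
  · exact h hij
  · rcases hi with rfl | rfl <;> rcases hj with hj | hj
    · exact h hj
    · have := h hj
      subst this
      exact absurd hij.symm (hα j)
    · have := h hj
      subst this
      exact absurd hij (hα i)
    · exact add_right_cancel (h hj)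

theorem mk_eq_of_mem_pair {a b u v : X} (huv : u ≠ v) (hu : u = a ∨ u = b) (hv : v = a ∨ v = b) :
    s(a, b) = s(u, v) := by
  rcases hu with rfl | rfl <;> rcases hv with rfl | rfl <;> simp_all [Sym2.eq_swap]

theorem mem_pair_of_mk_eq {a b u v : X} (h : s(a, b) = s(u, v)) :
    (u = a ∨ u = b) ∧ (v = a ∨ v = b) := by
  rcases Sym2.eq_iff.1 h with ⟨rfl, rfl⟩ | ⟨rfl, rfl⟩ <;> simp

theorem IsClosedTrail.index_eq {φ : ZMod ℓ → X} (hφ : IsClosedTrail φ) {i j : ZMod ℓ} {u v : X}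
    (huv : u ≠ v) (h1 : u = φ i ∨ u = φ (i + 1)) (h2 : v = φ i ∨ v = φ (i + 1))
    (h3 : u = φ j ∨ u = φ (j + 1)) (h4 : v = φ j ∨ v = φ (j + 1)) : i = j :=
  hφ.2 ((mk_eq_of_mem_pair huv h1 h2).trans (mk_eq_of_mem_pair huv h3 h4).symm)

variable {φ : ZMod ℓ → X} {ψ : ZMod ℓ → Y}

theorem trailGraph_adj_iff {u v : X} : (trailGraph φ).Adj u v ↔
    u ≠ v ∧ ∃ j, (u = φ j ∨ u = φ (j + 1)) ∧ (v = φ j ∨ v = φ (j + 1)) :=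
  and_congr_right fun h => exists_congr fun _ =>
    ⟨mem_pair_of_mk_eq, fun h' => mk_eq_of_mem_pair h h'.1 h'.2⟩

theorem hasCliqueDecomposition_cross_left (hφ : IsClosedTrail φ) (hψ : IsClosedTrail ψ)
    (h : Function.Injective φ ∨ Function.Injective ψ) :
    HasCliqueDecomposition 3 (glue (trailGraph φ) (cross φ ψ) ⊥) := by
  classical
  refine ⟨_, IsCliqueDecomposition.of_triples
    (fun j => {.inl (φ j), .inl (φ (j + 1)), .inr (ψ j)}) ?_ ?_ ?_⟩
  · intro j
    rw [card_eq_three]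
    exact ⟨_, _, _, by simpa using hφ.1 j, by simp, by simp, rfl⟩
  · rintro i j (u | u) (v | v) huv <;> simp <;> intro h1 h2 h3 h4
    · exact hφ.index_eq (by simpa using huv) h1 h2 h3 h4
    · exact eq_of_common_incidence hψ.1 h.symm (h2.symm.trans h4) h1 h3
    · exact eq_of_common_incidence hψ.1 h.symm (h1.symm.trans h3) h2 h4
    · exact absurd (h1.trans h2.symm) (by simpa using huv)
  · rintro (u | u) (v | v)
    · simp [trailGraph_adj_iff]
    · simp [cross, eq_comm, and_comm]
    · simp [cross, eq_comm]
    · simp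
      intro huv i hi hv
      exact huv (hi.trans hv.symm)

theorem hasCliqueDecomposition_cross_right (hφ : IsClosedTrail φ) (hψ : IsClosedTrail ψ)
    (h : Function.Injective φ ∨ Function.Injective ψ) :
    HasCliqueDecomposition 3 (glue ⊥ (cross φ ψ) (trailGraph ψ)) := by
  classical
  have h' : Function.Injective (fun j => φ (j + 1)) ∨ Function.Injective ψ :=
    h.imp_left fun h => h.comp (add_left_injective 1)
  have hφ' : ∀ j, φ (j + 1) ≠ φ (j + 1 + 1) := fun j => hφ.1 (j + 1)
  refine ⟨_, IsCliqueDecomposition.of_triples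
    (fun j => {.inr (ψ j), .inr (ψ (j + 1)), .inl (φ (j + 1))}) ?_ ?_ ?_⟩
  · intro j
    rw [card_eq_three]
    exact ⟨_, _, _, by simpa using hψ.1 j, by simp, by simp, rfl⟩
  · rintro i j (u | u) (v | v) huv <;> simp <;> intro h1 h2 h3 h4
    · exact absurd (h1.trans h2.symm) (by simpa using huv)
    · exact eq_of_common_incidence (α := fun j => φ (j + 1)) hφ' h' (h1.symm.trans h3) h2 h4
    · exact eq_of_common_incidence (α := fun j => φ (j + 1)) hφ' h' (h2.symm.trans h4) h1 h3
    · exact hψ.index_eq (by simpa using huv) h1 h2 h3 h4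
  -- The same cross edges grouped by their other end: `φ (j + 1)` sees both ends of the `j`-th edge
  -- of `ψ`.
  · have key : ∀ x y, cross φ ψ x y ↔ ∃ j, x = φ (j + 1) ∧ (y = ψ j ∨ y = ψ (j + 1)) := by
      intro x y
      constructor
      · rintro ⟨j, rfl, rfl | rfl⟩
        · exact ⟨j - 1, by simp⟩
        · exact ⟨j, by simp⟩
      · rintro ⟨j, rfl, rfl | rfl⟩
        · exact ⟨j, by simp⟩
        · exact ⟨j + 1, by simp⟩
    rintro (u | u) (v | v)
    · simp
      intro huv i hi hv
      exact huv (hi.trans hv.symm)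
    · simp [key]
    · simp [key, and_comm]
    · simp [trailGraph_adj_iff]

/-- Adding a layer outside the closed trail `ψ` gives an absorber of the closed trail `φ`. -/
theorem hasCliqueDecomposition_layer (hφ : IsClosedTrail φ) (hψ : IsClosedTrail ψ)
    (h : Function.Injective φ ∨ Function.Injective ψ) {A B : SimpleGraph Y}
    (hA : HasCliqueDecomposition 3 A) (hB : HasCliqueDecomposition 3 B)
    (hAB : B = trailGraph ψ ⊔ A) (hd : ∀ u v, (trailGraph ψ).Adj u v → ¬ A.Adj u v) :
    HasCliqueDecomposition 3 (glue ⊥ (cross φ ψ) B) ∧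
      HasCliqueDecomposition 3 (glue (trailGraph φ) (cross φ ψ) B) := by
  constructor
  · rw [hAB]
    exact (hasCliqueDecomposition_cross_right hφ hψ h).glue_right hA hd
  · rw [← bot_sup_eq B]
    exact (hasCliqueDecomposition_cross_left hφ hψ h).glue_right hB (by simp)

end Glue

/-! ### Counting edges inside vertex sets -/

section EdgesIn

variable {X Y : Type*}

/-- The number of edges of `G` inside `S`. -/
noncomputable def edgesIn (G : SimpleGraph X) (S : Finset X) : ℕ :=
  {e ∈ G.edgeSet | ∀ v ∈ e, v ∈ S}.ncard

open Classical in
/-- The number of pairs in `S × T` related by `C`. -/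
noncomputable def pairsIn (C : X → Y → Prop) (S : Finset X) (T : Finset Y) : ℕ :=
  {p ∈ S ×ˢ T | C p.1 p.2}.card

theorem finite_edgesIn (G : SimpleGraph X) (S : Finset X) :
    {e ∈ G.edgeSet | ∀ v ∈ e, v ∈ S}.Finite := by
  classical
  refine S.sym2.finite_toSet.subset fun e he => ?_
  exact mem_coe.2 (mem_sym2_iff.2 he.2)

theorem edgesIn_le_card {G : SimpleGraph X} {S : Finset X} (T : Finset (Sym2 X))
    (h : ∀ u v, G.Adj u v → u ∈ S → v ∈ S → s(u, v) ∈ T) : edgesIn G S ≤ T.card := by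
  rw [edgesIn, ← Set.ncard_coe_finset]
  refine Set.ncard_le_ncard ?_ T.finite_toSet
  rintro e ⟨he, heS⟩
  induction e using Sym2.ind with
  | _ u v => exact h u v he (heS u (by simp)) (heS v (by simp))

theorem edgesIn_of_card_le_one {G : SimpleGraph X} {S : Finset X} (h : S.card ≤ 1) :
    edgesIn G S = 0 := by
  refine Nat.le_zero.1 (edgesIn_le_card ∅ fun u v huv hu hv => ?_)
  exact absurd (card_le_one.1 h u hu v hv) huv.ne

theorem edgesIn_of_card_eq_two {G : SimpleGraph X} {S : Finset X} (h : S.card = 2) :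
    edgesIn G S ≤ 1 := by
  classical
  obtain ⟨x, y, -, rfl⟩ := card_eq_two.1 h
  refine edgesIn_le_card {s(x, y)} fun u v huv hu hv => ?_
  have := huv.ne
  simp only [mem_insert, mem_singleton] at hu hv ⊢
  exact (mk_eq_of_mem_pair this hu hv).symm

theorem edgesIn_bot (S : Finset X) : edgesIn ⊥ S = 0 :=
  Nat.le_zero.1 (edgesIn_le_card ∅ fun _ _ h => h.elim)

theorem ncard_edgeSet_le_edgesIn {G : SimpleGraph X} (H : G.Subgraph) {S : Finset X}
    (h : H.verts = S) : H.edgeSet.ncard ≤ edgesIn G S := by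
  refine Set.ncard_le_ncard (fun e he => ⟨H.edgeSet_subset he, fun v hv => ?_⟩)
    (finite_edgesIn G S)
  exact h.le (H.mem_verts_of_mem_edge he hv)

theorem edgesIn_glue_le (G : SimpleGraph X) (C : X → Y → Prop) (H : SimpleGraph Y)
    (S : Finset (X ⊕ Y)) :
    edgesIn (glue G C H) S ≤
      edgesIn G S.toLeft + pairsIn C S.toLeft S.toRight + edgesIn H S.toRight := by
  classical
  have hG := finite_edgesIn G S.toLeft
  have hH := finite_edgesIn H S.toRight
  refine (edgesIn_le_card (hG.toFinset.image (Sym2.map Sum.inl) ∪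
    ((S.toLeft ×ˢ S.toRight).filter fun p => C p.1 p.2).image
      (fun p => s(Sum.inl p.1, Sum.inr p.2)) ∪ hH.toFinset.image (Sym2.map Sum.inr)) ?_).trans ?_
  · rintro (u | u) (v | v) huv hu hv
    · refine mem_union_left _ (mem_union_left _ (mem_image.2 ⟨s(u, v), ?_, by simp⟩))
      simpa using ⟨huv, hu, hv⟩
    · refine mem_union_left _ (mem_union_right _ (mem_image.2 ⟨(u, v), ?_, by simp⟩))
      simpa using ⟨⟨hu, hv⟩, huv⟩
    · refine mem_union_left _ (mem_union_right _ (mem_image.2 ⟨(v, u), ?_, by simp⟩))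
      simpa using ⟨⟨hv, hu⟩, huv⟩
    · refine mem_union_right _ (mem_image.2 ⟨s(u, v), ?_, by simp⟩)
      simpa using ⟨huv, hu, hv⟩
  · refine (card_union_le _ _).trans (add_le_add ((card_union_le _ _).trans (add_le_add ?_ ?_)) ?_)
    · exact card_image_le.trans (by rw [edgesIn, Set.ncard_eq_toFinset_card _ hG])
    · exact card_image_le
    · exact card_image_le.trans (by rw [edgesIn, Set.ncard_eq_toFinset_card _ hH])

theorem pairsIn_le_mul (C : X → Y → Prop) (S : Finset X) (T : Finset Y) :
    pairsIn C S T ≤ S.card * T.card := by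
  classical
  exact (card_filter_le _ _).trans (card_product _ _).le

theorem pairsIn_le_left {C : X → Y → Prop} {n : ℕ} {S : Finset X} {T : Finset Y}
    (h : ∀ x, ∃ t : Finset Y, t.card ≤ n ∧ ∀ y, C x y → y ∈ t) :
    pairsIn C S T ≤ n * S.card := by
  classical
  choose t ht hCt using h
  refine (card_le_card (t := S.biUnion fun x => (t x).image fun y => (x, y)) ?_).trans ?_
  · rintro ⟨x, y⟩ hp
    simp only [mem_filter, mem_product] at hp
    simpa using ⟨hp.1.1, hCt x y hp.2⟩
  · rw [mul_comm]
    exact card_biUnion_le_card_mul _ _ _ fun x _ => card_image_le.trans (ht x)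

theorem pairsIn_swap (C : X → Y → Prop) (S : Finset X) (T : Finset Y) :
    pairsIn C S T = pairsIn (fun y x => C x y) T S := by
  classical
  refine card_bij (fun p _ => p.swap) ?_ ?_ ?_
  · rintro ⟨x, y⟩
    simp +contextual
  · rintro ⟨x, y⟩ _ ⟨x', y'⟩ _
    simp +contextual
  · rintro ⟨x, y⟩ h
    refine ⟨(y, x), ?_, rfl⟩
    simpa [and_comm, and_assoc, and_left_comm] using h

theorem pairsIn_le_right {C : X → Y → Prop} {n : ℕ} {S : Finset X} {T : Finset Y}
    (h : ∀ y, ∃ t : Finset X, t.card ≤ n ∧ ∀ x, C x y → x ∈ t) :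
    pairsIn C S T ≤ n * T.card := by
  rw [pairsIn_swap]
  exact pairsIn_le_left h

theorem pairsIn_le_pairsIn {C : X → Y → Prop} {S : Finset X} {T T' : Finset Y}
    (h : ∀ x y, C x y → y ∈ T → y ∈ T') : pairsIn C S T ≤ pairsIn C S T' := by
  classical
  refine card_le_card fun p => ?_
  simp only [mem_filter, mem_product]
  exact fun hp => ⟨⟨hp.1.1, h _ _ hp.2 hp.1.2⟩, hp.2⟩

variable {ℓ : ℕ}

theorem exists_card_le_two_of_cross_left {φ : ZMod ℓ → X} {ψ : ZMod ℓ → Y}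
    (h : Function.Injective φ) (x : X) :
    ∃ t : Finset Y, t.card ≤ 2 ∧ ∀ y, cross φ ψ x y → y ∈ t := by
  classical
  by_cases hx : ∃ i, φ i = x
  · obtain ⟨i, rfl⟩ := hx
    refine ⟨{ψ i, ψ (i - 1)}, card_le_two, ?_⟩
    rintro y ⟨j, rfl, hj | hj⟩
    · simp [h hj]
    · simp [h hj]
  · refine ⟨∅, by simp, ?_⟩
    rintro y ⟨j, -, rfl | rfl⟩ <;> simp at hx

theorem exists_card_le_two_of_cross_right {φ : ZMod ℓ → X} {ψ : ZMod ℓ → Y}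
    (h : Function.Injective ψ) (y : Y) :
    ∃ t : Finset X, t.card ≤ 2 ∧ ∀ x, cross φ ψ x y → x ∈ t := by
  classical
  by_cases hy : ∃ i, ψ i = y
  · obtain ⟨i, rfl⟩ := hy
    refine ⟨{φ i, φ (i + 1)}, card_le_two, ?_⟩
    rintro x ⟨j, hj, hx⟩
    simpa [h hj] using hx
  · refine ⟨∅, by simp, ?_⟩
    rintro x ⟨j, rfl, -⟩
    simp at hy

/-- The cycle on `ZMod ℓ`. -/
abbrev cycle (ℓ : ℕ) : SimpleGraph (ZMod ℓ) := trailGraph id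

theorem edgesIn_cycle_le (S : Finset (ZMod ℓ)) :
    edgesIn (cycle ℓ) S ≤ S.card := by
  classical
  refine (edgesIn_le_card (S.image fun j => s(j, j + 1)) ?_).trans card_image_le
  rintro u v ⟨-, j, hj⟩ hu hv
  refine mem_image.2 ⟨j, ?_, hj⟩
  have := (mem_pair_of_mk_eq hj.symm).1
  simp only [id] at this
  rcases this with rfl | rfl
  exacts [hu, hv]

end EdgesIn

/-! ### The chain of triangles -/

section Chain

variable (n : ℕ)

/-- A chain of `n` triangles, each joining an edge of a path to a private vertex. -/
def chain : SimpleGraph (Fin n ⊕ Fin (n + 1)) :=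
  glue ⊥ (fun i a => a = i.castSucc ∨ a = i.succ) (pathGraph (n + 1))

theorem isCliqueDecomposition_chain : ∃ t : Fin n → Finset (Fin n ⊕ Fin (n + 1)),
    Function.Injective t ∧ IsCliqueDecomposition 3 (chain n) (Set.range t) := by
  classical
  refine ⟨fun i => {.inl i, .inr i.castSucc, .inr i.succ}, ?_,
    IsCliqueDecomposition.of_triples _ ?_ ?_ ?_⟩
  · intro i j hij
    have : Sum.inl i ∈ ({.inl j, .inr j.castSucc, .inr j.succ} :
        Finset (Fin n ⊕ Fin (n + 1))) := by
      simp only at hij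
      rw [← hij]
      simp
    simpa using this
  · intro i
    rw [card_eq_three]
    refine ⟨_, _, _, by simp, by simp, ?_, rfl⟩
    simpa using (Fin.castSucc_lt_succ (i := i)).ne
  · rintro i j (u | u) (v | v) huv <;> simp <;> intro h1 h2 h3 h4
    · exact h1.symm.trans h3
    · exact h1.symm.trans h3
    · exact h2.symm.trans h4
    · have huv' : u.val ≠ v.val := fun h => huv (by rw [Fin.ext h])
      simp only [Fin.ext_iff, Fin.val_castSucc, Fin.val_succ] at h1 h2 h3 h4 ⊢
      omega
  · rintro (u | u) (v | v)
    · simp [chain]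
      exact fun h h' => h h'.symm
    · simp [chain]
    · simp [chain]
    · simp only [chain, glue_inr_inr, pathGraph_adj, mem_insert, mem_singleton, reduceCtorEq,
        Sum.inr.injEq, false_or, ne_eq, Fin.ext_iff, Fin.val_castSucc, Fin.val_succ]
      constructor
      · rintro (h | h)
        · exact ⟨by omega, ⟨u.val, by omega⟩, by simp, by simp [h]⟩
        · exact ⟨by omega, ⟨v.val, by omega⟩, by simp [h], by simp⟩
      · rintro ⟨h, i, h1, h2⟩
        omega

theorem hasCliqueDecomposition_chain : HasCliqueDecomposition 3 (chain n) :=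
  let ⟨_, _, h⟩ := isCliqueDecomposition_chain n
  ⟨_, h⟩

theorem ncard_edgeSet_chain : (chain n).edgeSet.ncard = 3 * n := by
  obtain ⟨t, ht, h⟩ := isCliqueDecomposition_chain n
  rw [h.ncard_edgeSet, Set.ncard_range_of_injective ht, Nat.card_eq_fintype_card, Fintype.card_fin]

theorem even_ncard_neighborSet_chain (v : Fin n ⊕ Fin (n + 1)) :
    Even ((chain n).neighborSet v).ncard := by
  obtain ⟨t, -, h⟩ := isCliqueDecomposition_chain n
  rw [h.ncard_neighborSet]
  exact even_two_mul _

theorem connected_chain : (chain n).Connected := by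
  let f : pathGraph (n + 1) →g chain n := ⟨Sum.inr, fun h => h⟩
  have hr : ∀ a b, (chain n).Reachable (.inr a) (.inr b) := fun a b =>
    ((pathGraph_connected n).preconnected a b).map f
  have hl : ∀ i : Fin n, (chain n).Reachable (.inl i) (.inr 0) := fun i =>
    (show (chain n).Adj (.inl i) (.inr i.castSucc) from Or.inl rfl).reachable.trans (hr _ _)
  have h0 : ∀ u, (chain n).Reachable u (.inr 0) := by
    rintro (i | a)
    exacts [hl i, hr a 0]
  exact ⟨fun u v => (h0 u).trans (h0 v).symm⟩

/-- Charge each edge to its smaller end; the largest vertex of `S` is charged nothing. -/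
theorem edgesIn_pathGraph_lt {S : Finset (Fin (n + 1))} (hS : S.Nonempty) :
    edgesIn (pathGraph (n + 1)) S < S.card := by
  classical
  rw [← card_erase_add_one (S.max'_mem hS), Nat.lt_succ_iff]
  refine (edgesIn_le_card ((S.erase (S.max' hS)).image fun j => s(j, j + 1)) ?_).trans card_image_le
  have key : ∀ u v : Fin (n + 1), u.val + 1 = v.val → u ∈ S → v ∈ S →
      s(u, v) ∈ (S.erase (S.max' hS)).image fun j => s(j, j + 1) := by
    intro u v huv hu hv
    have hlt : u < v := Fin.lt_def.2 (by omega)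
    refine mem_image.2 ⟨u, mem_erase.2 ⟨(hlt.trans_le (S.le_max' v hv)).ne, hu⟩, ?_⟩
    have : u + 1 = v := by
      ext
      rw [Fin.val_add_one_of_lt (hlt.trans_le (Fin.le_last v)), huv]
    rw [this]
  intro u v huv hu hv
  rcases pathGraph_adj.1 huv with h | h
  · exact key u v h hu hv
  · rw [Sym2.eq_swap]
    exact key v u h hv hu

theorem edgesIn_pathGraph_le (S : Finset (Fin (n + 1))) :
    edgesIn (pathGraph (n + 1)) S ≤ S.card := by
  rcases S.eq_empty_or_nonempty with rfl | h
  · rw [edgesIn_of_card_le_one (by simp)]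
    simp
  · exact (edgesIn_pathGraph_lt n h).le

/-- A path vertex pays for one path edge and its at most two edges to private vertices. Private
vertices pay nothing, which is why the roots are placed there. -/
theorem edgesIn_chain_le_right (S : Finset (Fin n ⊕ Fin (n + 1))) :
    edgesIn (chain n) S ≤ 3 * S.toRight.card := by
  classical
  have h1 := edgesIn_glue_le (⊥ : SimpleGraph (Fin n)) (fun i a => a = i.castSucc ∨ a = i.succ)
    (pathGraph (n + 1)) S
  have h2 : pairsIn (fun (i : Fin n) a => a = i.castSucc ∨ a = i.succ) S.toLeft S.toRight ≤
      2 * S.toRight.card := by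
    refine pairsIn_le_right fun a => ⟨univ.filter fun i => a = i.castSucc ∨ a = i.succ, ?_, by simp⟩
    rw [filter_or]
    refine (card_union_le _ _).trans (add_le_add (b := 1) (d := 1) ?_ ?_) <;>
    · rw [card_le_one]
      intro i hi j hj
      simp only [mem_filter, mem_univ, true_and] at hi hj
      simpa using hi.symm.trans hj
  have h3 := edgesIn_pathGraph_le n S.toRight
  rw [edgesIn_bot] at h1
  exact h1.trans (by omega)

theorem edgesIn_chain_le (S : Finset (Fin n ⊕ Fin (n + 1))) :
    edgesIn (chain n) S ≤ 2 * (S.card - 1) := by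
  classical
  have h1 := edgesIn_glue_le (⊥ : SimpleGraph (Fin n)) (fun i a => a = i.castSucc ∨ a = i.succ)
    (pathGraph (n + 1)) S
  have h2 : pairsIn (fun (i : Fin n) a => a = i.castSucc ∨ a = i.succ) S.toLeft S.toRight ≤
      2 * S.toLeft.card :=
    pairsIn_le_left fun i => ⟨{i.castSucc, i.succ}, card_le_two, by simp⟩
  have h3 := S.card_toLeft_add_card_toRight
  rw [edgesIn_bot] at h1
  rcases S.toRight.eq_empty_or_nonempty with h | h
  · have h4 := pairsIn_le_mul (fun (i : Fin n) a => a = i.castSucc ∨ a = i.succ)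
      S.toLeft S.toRight
    rw [h] at h1 h4
    rw [card_empty, mul_zero] at h4
    rw [edgesIn_of_card_le_one (S := ∅) (by simp)] at h1
    exact h1.trans (by omega)
  · have h4 := edgesIn_pathGraph_lt n h
    exact h1.trans (by omega)

theorem edgesIn_chain_add_le {S : Finset (Fin n ⊕ Fin (n + 1))} (hS : 2 ≤ S.card) :
    edgesIn (chain n) S + 5 ≤ 3 * S.card := by
  rcases hS.eq_or_lt with h | h
  · have := edgesIn_of_card_eq_two (G := chain n) h.symm
    omega
  · have := edgesIn_chain_le n S
    omega

end Chain

/-! ### Nested cycles and the shifting of charges -/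

section Rings

variable {W : Type*} {ℓ : ℕ}

theorem glue_cycle_eq_sup (C : ZMod ℓ → W → Prop) (H : SimpleGraph W) :
    glue (cycle ℓ) C H = trailGraph Sum.inl ⊔ glue ⊥ C H := by
  ext (x | y) (x' | y') <;> simp [trailGraph_adj_iff]

theorem isClosedTrail_inl (h : 3 ≤ ℓ) : IsClosedTrail (Sum.inl : ZMod ℓ → ZMod ℓ ⊕ W) := by
  refine ⟨fun j hj => (isClosedTrail_id h).1 j (Sum.inl_injective hj), fun i j hij => ?_⟩
  apply (isClosedTrail_id h).2
  simpa using hij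

theorem not_glue_bot_of_trailGraph_inl (C : ZMod ℓ → W → Prop) (H : SimpleGraph W)
    (u v : ZMod ℓ ⊕ W) (h : (trailGraph (Sum.inl : ZMod ℓ → ZMod ℓ ⊕ W)).Adj u v) :
    ¬ (glue ⊥ C H).Adj u v := by
  obtain ⟨-, j, hu, hv⟩ := trailGraph_adj_iff.1 h
  rcases u with u | u <;> rcases v with v | v <;> simp_all

/-- Attaching a cycle whose vertices have at most two neighbours further inside preserves the bound
`e(S) ≤ 3 |S| - 5`. -/
theorem edgesIn_glue_cycle_add_le {C : ZMod ℓ → W → Prop} {H : SimpleGraph W}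
    (hC : ∀ x, ∃ t : Finset W, t.card ≤ 2 ∧ ∀ y, C x y → y ∈ t)
    (hH : ∀ S : Finset W, 2 ≤ S.card → edgesIn H S + 5 ≤ 3 * S.card)
    {S : Finset (ZMod ℓ ⊕ W)} (hS : 2 ≤ S.card) :
    edgesIn (glue (cycle ℓ) C H) S + 5 ≤ 3 * S.card := by
  rcases hS.eq_or_lt with h | h
  · have := edgesIn_of_card_eq_two (G := glue (cycle ℓ) C H) h.symm
    omega
  have h1 := edgesIn_glue_le (cycle ℓ) C H S
  have h2 := edgesIn_cycle_le S.toLeft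
  have h3 := S.card_toLeft_add_card_toRight
  have h4 := pairsIn_le_left (S := S.toLeft) (T := S.toRight) hC
  rcases Nat.lt_or_ge 1 S.toRight.card with h5 | h5
  · have := hH _ h5
    omega
  · rw [edgesIn_of_card_le_one h5] at h1
    have h6 := pairsIn_le_mul C S.toLeft S.toRight
    -- Here e(S) ≤ a for no inner vertex and e(S) ≤ 2a for one, where a counts the cycle vertices;
    -- |S| ≥ 3 then suffices.
    interval_cases S.toRight.card <;> omega

/-- Cross edges reach only the outer cycle of the inner graph, and each of its vertices carries at
most two. -/
theorem pairsIn_cross_inl_le {X : Type*} (φ : ZMod ℓ → X) (S : Finset X)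
    (T : Finset (ZMod ℓ ⊕ W)) : pairsIn (cross φ Sum.inl) S T ≤ 2 * T.toLeft.card ∧
      pairsIn (cross φ Sum.inl) S T ≤ S.card * T.toLeft.card := by
  have h : pairsIn (cross φ Sum.inl) S T ≤
      pairsIn (Y := ZMod ℓ ⊕ W) (cross φ Sum.inl) S (T.toLeft.map Function.Embedding.inl) := by
    refine pairsIn_le_pairsIn ?_
    rintro x _ ⟨j, rfl, -⟩ hj
    simpa using hj
  constructor
  · refine h.trans ((pairsIn_le_right (n := 2)
      (exists_card_le_two_of_cross_right Sum.inl_injective)).trans ?_)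
    rw [card_map]
  · refine h.trans ((pairsIn_le_mul _ _ _).trans ?_)
    rw [card_map]

/-- There are absorbers of the cycle of length `3 k` whose edges inside the root cycle and beyond
can be distributed so that a non-root vertex gets at most `3 + ε` and a root at most `3 - m ε`. -/
theorem exists_cycle_absorber {k : ℕ} (hk : 1 ≤ k) {ε : ℝ} (hε : 0 ≤ ε) (m : ℕ)
    (hm : m * ε ≤ 2) :
    ∃ (W : Type) (_ : Fintype W) (C : ZMod (3 * k) → W → Prop) (H : SimpleGraph W),
      Fintype.card W = m * (3 * k) + 2 * k + 1 ∧
      HasCliqueDecomposition 3 (glue ⊥ C H) ∧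
      HasCliqueDecomposition 3 (glue (cycle (3 * k)) C H) ∧
      (∀ S, (edgesIn (glue (cycle (3 * k)) C H) S : ℝ) ≤
        (3 + ε) * S.toRight.card + (3 - m * ε) * S.toLeft.card) ∧
      ∀ S, 2 ≤ S.card → edgesIn (glue (cycle (3 * k)) C H) S + 5 ≤ 3 * S.card := by
  have h3 : 3 ≤ 3 * k := by omega
  have : NeZero (3 * k) := ⟨by omega⟩
  have hid := isClosedTrail_id h3
  induction m with
  | zero =>
    -- The chain of `k` triangles has an Euler trail of length `3 * k`, matching the cycle, and
    -- needs no absorber since it decomposes itself.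
    obtain ⟨ψ, hψ, hψc⟩ := exists_closedTrail (connected_chain k)
      (even_ncard_neighborSet_chain k) (ncard_edgeSet_chain k) (by omega)
    obtain ⟨hA, hB⟩ := hasCliqueDecomposition_layer hid hψ (Or.inl Function.injective_id)
      (hasCliqueDecomposition_bot 3) (hasCliqueDecomposition_chain k) (by rw [hψc, sup_bot_eq])
      (by simp)
    have hC : ∀ x, ∃ t : Finset _, t.card ≤ 2 ∧ ∀ y, cross id ψ x y → y ∈ t :=
      exists_card_le_two_of_cross_left Function.injective_id
    refine ⟨_, inferInstance, cross id ψ, chain k, ?_, hA, hB, fun S => ?_, fun S hS => ?_⟩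
    · simp
      omega
    · have h1 := edgesIn_glue_le (cycle (3 * k)) (cross id ψ) (chain k) S
      have h2 := edgesIn_cycle_le S.toLeft
      have h4 := pairsIn_le_left (S := S.toLeft) (T := S.toRight) hC
      have h5 := edgesIn_chain_le k S.toRight
      have h6 : edgesIn (glue (cycle (3 * k)) (cross id ψ) (chain k)) S ≤
          3 * S.toRight.card + 3 * S.toLeft.card := by omega
      have h7 : (edgesIn (glue (cycle (3 * k)) (cross id ψ) (chain k)) S : ℝ) ≤
          3 * S.toRight.card + 3 * S.toLeft.card := by exact_mod_cast h6
      have h8 : 0 ≤ ε * S.toRight.card := by positivity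
      push_cast
      linarith
    · exact edgesIn_glue_cycle_add_le hC (fun S => edgesIn_chain_add_le k) hS
  | succ m ih =>
    push_cast at hm
    obtain ⟨W, _, C, H, hW, hA, hB, hD, hQ⟩ := ih (by linarith)
    obtain ⟨hA', hB'⟩ := hasCliqueDecomposition_layer hid (isClosedTrail_inl h3)
      (Or.inl Function.injective_id) hA hB (glue_cycle_eq_sup C H)
      (not_glue_bot_of_trailGraph_inl C H)
    have hC : ∀ x, ∃ t : Finset (ZMod (3 * k) ⊕ W), t.card ≤ 2 ∧
        ∀ y, cross id Sum.inl x y → y ∈ t :=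
      exists_card_le_two_of_cross_left Function.injective_id
    refine ⟨_, inferInstance, cross id Sum.inl, glue (cycle (3 * k)) C H, ?_, hA', hB',
      fun S => ?_, fun S hS => edgesIn_glue_cycle_add_le hC hQ hS⟩
    · rw [Fintype.card_sum, hW, ZMod.card]
      ring
    · have h1 := edgesIn_glue_le (cycle (3 * k)) (cross id Sum.inl) (glue (cycle (3 * k)) C H) S
      have h2 := edgesIn_cycle_le S.toLeft
      have h4 := pairsIn_le_left (S := S.toLeft) (T := S.toRight) hC
      have h5 := (pairsIn_cross_inl_le (W := W) id S.toLeft S.toRight).1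
      have h6 := hD S.toRight
      have h7 := S.toRight.card_toLeft_add_card_toRight
      rify at h1 h2 h4 h5 h7
      -- The roots pay the fraction 1 - (m + 1)ε/2 of the cross edges and the next cycle the rest.
      -- That cycle's charge rises from 3 - mε by (m + 1)ε, to exactly 3 + ε.
      have h8 := mul_le_mul_of_nonneg_left h4 (show 0 ≤ 2 - (m + 1) * ε by linarith)
      have h9 := mul_le_mul_of_nonneg_left h5 (show 0 ≤ (m + 1) * ε by positivity)
      push_cast
      rw [← h7]
      linarith

end Rings

/-! ### Density of the full absorber -/

section Density

variable {W : Type*}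

theorem maxRootedTwoDensity_le [Finite W] {A : SimpleGraph W} {R : Set W} {r : ℝ}
    (h1 : ∀ S : Finset W, (edgesIn A S : ℝ) ≤ r * ((S : Set W) \ R).ncard)
    (h2 : ∀ S : Finset W, 3 ≤ S.card → (edgesIn A S : ℝ) - 1 ≤ r * (S.card - 2)) :
    maxRootedTwoDensity A R ≤ (r : EReal) := by
  classical
  refine max_le (iSup₂_le fun H hH => ?_) (iSup₂_le fun H hH => ?_)
  · have hS : H.verts = (H.verts.toFinite.toFinset : Set W) := by simp
    have hpos : (0 : ℝ) < (H.verts \ R).ncard := by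
      exact_mod_cast (Set.ncard_pos).2 hH
    rw [EReal.coe_le_coe_iff, div_le_iff₀ hpos]
    have := h1 H.verts.toFinite.toFinset
    rw [← hS] at this
    exact le_trans (by exact_mod_cast ncard_edgeSet_le_edgesIn H hS) this
  · have hS : H.verts = (H.verts.toFinite.toFinset : Set W) := by simp
    have hcard : H.verts.ncard = H.verts.toFinite.toFinset.card :=
      Set.ncard_eq_toFinset_card _ _
    have hpos : (0 : ℝ) < (H.verts.ncard : ℝ) - 2 := by
      have : (3 : ℝ) ≤ H.verts.ncard := by exact_mod_cast hH
      linarith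
    rw [EReal.coe_le_coe_iff, div_le_iff₀ hpos]
    have := h2 H.verts.toFinite.toFinset (hcard ▸ hH)
    rw [← hcard] at this
    have h3 : (H.edgeSet.ncard : ℝ) ≤ edgesIn A H.verts.toFinite.toFinset := by
      exact_mod_cast ncard_edgeSet_le_edgesIn H hS
    linarith

variable {ℓ n : ℕ} {B : SimpleGraph (ZMod ℓ ⊕ W)} {ε : ℝ}

/-- With charge only 1, an outer cycle vertex can also pay for its at most two edges to the chain,
reaching 3. -/
theorem edgesIn_glue_chain_le (φ : ZMod ℓ → Fin n ⊕ Fin (n + 1))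
    (hD : ∀ S, (edgesIn B S : ℝ) ≤ (3 + ε) * S.toRight.card + 1 * S.toLeft.card)
    (hε : 0 ≤ ε) (S : Finset ((Fin n ⊕ Fin (n + 1)) ⊕ (ZMod ℓ ⊕ W))) :
    (edgesIn (glue (chain n) (cross φ Sum.inl) B) S : ℝ) ≤
      edgesIn (chain n) S.toLeft + (3 + ε) * S.toRight.card := by
  have h1 := edgesIn_glue_le (chain n) (cross φ Sum.inl) B S
  have h5 := (pairsIn_cross_inl_le (W := W) φ S.toLeft S.toRight).1
  have h6 := hD S.toRight
  have h7 := S.toRight.card_toLeft_add_card_toRight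
  rify at h1 h5 h7
  have h8 : 0 ≤ ε * S.toRight.toLeft.card := by positivity
  rw [← h7]
  linarith

/-- If `S` has two chain vertices, the chain already saves 5 and the charging handles the rest.
Otherwise the cycle part must supply the saving. -/
theorem edgesIn_glue_chain_sub_one_le (φ : ZMod ℓ → Fin n ⊕ Fin (n + 1))
    (hD : ∀ S, (edgesIn B S : ℝ) ≤ (3 + ε) * S.toRight.card + 1 * S.toLeft.card)
    (hQ : ∀ S, 2 ≤ S.card → edgesIn B S + 5 ≤ 3 * S.card)
    (hε : 0 ≤ ε) (S : Finset ((Fin n ⊕ Fin (n + 1)) ⊕ (ZMod ℓ ⊕ W))) (hS : 3 ≤ S.card) :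
    (edgesIn (glue (chain n) (cross φ Sum.inl) B) S : ℝ) - 1 ≤ (3 + ε) * (S.card - 2) := by
  have h0 := S.card_toLeft_add_card_toRight
  rcases Nat.lt_or_ge 1 S.toLeft.card with hL | hL
  · have h1 := edgesIn_glue_chain_le φ hD hε S
    have h2 := edgesIn_chain_add_le n hL
    rify at h0 h2 hL
    have h3 : 0 ≤ ε * (S.toLeft.card - 2) := mul_nonneg hε (by
      have : (2 : ℝ) ≤ S.toLeft.card := by exact_mod_cast hL
      linarith)
    rw [← h0]
    linarith
  · have h1 := edgesIn_glue_le (chain n) (cross φ Sum.inl) B S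
    have h5 := (pairsIn_cross_inl_le (W := W) φ S.toLeft S.toRight).2
    rw [edgesIn_of_card_le_one hL] at h1
    have h6 := hD S.toRight
    have h7 := S.toRight.card_toLeft_add_card_toRight
    have h8 := hQ S.toRight (by omega)
    rcases hL.eq_or_lt with hL | hL
    · rw [hL] at h5 h0
      -- A single chain vertex sends at most b edges to the b outer cycle vertices of `S`. For b ≥ 3
      -- the charging gives 2b plus 3 + ε per inner vertex; for b ≤ 2 these edges are absorbed by
      -- the bound 3|S| - 5 inside `B`.
      rcases Nat.lt_or_ge 2 S.toRight.toLeft.card with h9 | h9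
      · have h9' : (3 : ℝ) ≤ S.toRight.toLeft.card := by exact_mod_cast h9
        rify at h0 h1 h5 h7
        have h10 := mul_le_mul_of_nonneg_left h9' hε
        rw [← h0, ← h7]
        linarith
      · have h10 : edgesIn (glue (chain n) (cross φ Sum.inl) B) S + 6 ≤ 3 * S.card := by omega
        rify at h10 hS
        have h11 : 0 ≤ ε * (S.card - 2) := mul_nonneg hε (by linarith)
        linarith
    · have hL0 : S.toLeft.card = 0 := by omega
      rw [hL0] at h5 h0
      have h10 : edgesIn (glue (chain n) (cross φ Sum.inl) B) S + 5 ≤ 3 * S.card := by omega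
      rify at h10 hS
      have h11 : 0 ≤ ε * (S.card - 2) := mul_nonneg hε (by linarith)
      linarith

end Density

/-! ### Assembling the absorber -/

section Main

theorem even_ncard_neighborSet_map {V W : Type*} {L : SimpleGraph V} (f : V ↪ W)
    (h : ∀ v, Even (L.neighborSet v).ncard) (w : W) : Even ((L.map f).neighborSet w).ncard := by
  by_cases hw : ∃ v, f v = w
  · obtain ⟨v, rfl⟩ := hw
    have : (L.map f).neighborSet (f v) = f '' L.neighborSet v := by
      ext u
      simp only [mem_neighborSet, map_adj, Set.mem_image]
      constructor
      · rintro ⟨a, b, hab, ha, rfl⟩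
        exact ⟨b, f.injective ha ▸ hab, rfl⟩
      · rintro ⟨b, hb, rfl⟩
        exact ⟨v, b, hb, rfl, rfl⟩
    rw [this, Set.ncard_image_of_injective _ f.injective]
    exact h v
  · have : (L.map f).neighborSet w = ∅ := by
      ext u
      simp only [mem_neighborSet, map_adj, Set.mem_empty_iff_false, iff_false]
      rintro ⟨a, b, -, ha, -⟩
      exact hw ⟨a, ha⟩
    simp [this]

theorem ncard_edgeSet_le_sq {V : Type*} [Fintype V] (G : SimpleGraph V) :
    G.edgeSet.ncard ≤ Fintype.card V ^ 2 := by
  classical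
  rw [Set.ncard_eq_toFinset_card', ← edgeFinset]
  exact G.card_edgeFinset_le_card_choose_two.trans (Nat.choose_le_pow _ _)

/-- The graph `L` together with a chain of triangles is the graph of a closed trail whose length is
a multiple of three. -/
theorem exists_closedTrail_map_sup_chain {V : Type*} [Finite V] {L : SimpleGraph V}
    (hL : IsCliqueDivisible 3 L) {n : ℕ} (hn : 1 ≤ n) (e : V ↪ Fin n) :
    ∃ k, 1 ≤ k ∧ 3 * k ≤ (2 * n + 1) ^ 2 ∧ ∃ φ : ZMod (3 * k) → Fin n ⊕ Fin (n + 1),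
      IsClosedTrail φ ∧
        trailGraph φ = L.map (e.trans Function.Embedding.inl) ⊔ chain n := by
  set f : V ↪ Fin n ⊕ Fin (n + 1) := e.trans Function.Embedding.inl with hf
  have hdisj : Disjoint (L.map f) (chain n) := by
    rw [SimpleGraph.disjoint_left]
    rintro _ _ ⟨-, u, v, -, rfl, rfl⟩
    simp [hf, chain]
  have hdiv : 3 ∣ (L.map f ⊔ chain n).edgeSet.ncard := by
    rw [edgeSet_sup, Set.ncard_union_eq (disjoint_edgeSet.2 hdisj), ncard_edgeSet_chain,
      edgeSet_map, Set.ncard_image_of_injective _ f.sym2Map.injective]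
    exact dvd_add hL.1 (dvd_mul_right 3 n)
  obtain ⟨k, hk⟩ := hdiv
  have hk1 : 1 ≤ k := by
    have h1 := Set.ncard_le_ncard (edgeSet_subset_edgeSet.2 (le_sup_right (a := L.map f)
      (b := chain n)))
    rw [hk, ncard_edgeSet_chain] at h1
    omega
  refine ⟨k, hk1, ?_, exists_closedTrail ((connected_chain n).mono le_sup_right) ?_ hk (by omega)⟩
  · have := ncard_edgeSet_le_sq (L.map f ⊔ chain n)
    rw [hk, Fintype.card_sum, Fintype.card_fin, Fintype.card_fin] at this
    convert this using 2
    ring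
  · intro v
    have h1 : (L.map f ⊔ chain n).neighborSet v =
        (L.map f).neighborSet v ∪ (chain n).neighborSet v := by
      ext; simp
    rw [h1, Set.ncard_union_eq]
    · refine (even_ncard_neighborSet_map f (fun v => ?_) v).add (even_ncard_neighborSet_chain n v)
      exact even_iff_two_dvd.2 (hL.2 v)
    · rw [Set.disjoint_left]
      exact fun u hu hu' => SimpleGraph.disjoint_left.1 hdisj v u hu hu'

theorem isAchievable_three_add {M : ℕ} (hM : 1 ≤ M) : IsAchievable 3 (3 + 2 / M) := by
  intro C₁ _
  refine ⟨(2 * C₁ + 3) + (M + 2) * (2 * C₁ + 3) ^ 2 + 1, by omega, fun V _ L hV hL => ?_⟩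
  have hM0 : (0 : ℝ) < M := by exact_mod_cast hM
  have hε : (0 : ℝ) ≤ 2 / M := by positivity
  have hMε : (M : ℝ) * (2 / M) = 2 := by field_simp
  -- The extra triangle keeps the chain, and hence the trail, nonempty when `V` is empty.
  let n := Nat.card V + 1
  let e : V ↪ Fin n := (Finite.equivFin V).toEmbedding.trans Fin.castSuccEmb
  obtain ⟨k, hk, hkn, φ, hφ, hφL⟩ := exists_closedTrail_map_sup_chain hL (n := n) (by omega) e
  have : NeZero (3 * k) := ⟨by omega⟩
  obtain ⟨W, _, C, H, hW, hA, hB, hD, hQ⟩ := exists_cycle_absorber hk hε M hMε.le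
  -- After `M` layers the charge 3 - Mε of the outermost cycle has dropped to 1.
  rw [hMε] at hD
  norm_num only at hD
  obtain ⟨hA', hB'⟩ := hasCliqueDecomposition_layer hφ (isClosedTrail_inl (by omega))
    (Or.inr Sum.inl_injective) hA hB (glue_cycle_eq_sup C H) (not_glue_bot_of_trailGraph_inl C H)
  let B := glue (cycle (3 * k)) C H
  let f : V ↪ (Fin n ⊕ Fin (n + 1)) ⊕ (ZMod (3 * k) ⊕ W) :=
    (e.trans Function.Embedding.inl).trans Function.Embedding.inl
  refine ⟨_, inferInstance, f, glue (chain n) (cross φ Sum.inl) B, ?_, ⟨?_, ?_, ?_⟩,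
    maxRootedTwoDensity_le (fun S => ?_)
      (edgesIn_glue_chain_sub_one_le φ hD hQ hε)⟩
  · rw [Nat.card_eq_fintype_card]
    simp only [Fintype.card_sum, Fintype.card_fin, ZMod.card, hW]
    have h1 : 2 * n + 1 ≤ 2 * C₁ + 3 := by omega
    have h2 := hkn.trans (Nat.pow_le_pow_left h1 2)
    have h3 := Nat.mul_le_mul_left (M + 2) h2
    linarith
  · rintro _ ⟨u, rfl⟩ _ ⟨v, rfl⟩ -
    simp [f, chain]
  · rw [← bot_sup_eq (chain n)]
    exact hA'.glue_left (hasCliqueDecomposition_chain n) (by simp)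
  · convert hB' using 1
    rw [hφL]
    ext (x | y) (x' | y') <;> simp [f, B]
  · refine (edgesIn_glue_chain_le φ hD hε S).trans ?_
    have h1 := edgesIn_chain_le_right n S.toLeft
    -- All vertices that are charged, namely path vertices and the cycle part, lie outside the
    -- roots.
    have h2 : S.toLeft.toRight.card + S.toRight.card ≤ ((S : Set _) \ Set.range f).ncard := by
      rw [← card_map Function.Embedding.inr, ← card_disjSum, ← Set.ncard_coe_finset]
      refine Set.ncard_le_ncard ?_ (Set.toFinite _)
      rintro ((i | a) | y) h
      · simp at h
      · exact ⟨by simpa using h, by simp [f]⟩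
      · exact ⟨by simpa using h, by simp [f]⟩
    rify at h1 h2
    have h3 := mul_le_mul_of_nonneg_left h2 (show 0 ≤ 3 + 2 / (M : ℝ) by positivity)
    have h4 : 0 ≤ 2 / (M : ℝ) * S.toLeft.toRight.card := by positivity
    linarith

end Main

end TriangleAbsorber

theorem mainTheorem7 : TriangleAbsorber.dAbs 3 ≤ 3 := by
  refine EReal.le_of_forall_lt_iff_le.1 fun z hz => ?_
  have hz' : (3 : ℝ) < z := EReal.coe_lt_coe_iff.1 hz
  obtain ⟨M, hM⟩ := exists_nat_gt (2 / (z - 3))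
  have hpos : 0 < 2 / (z - 3) := div_pos two_pos (by linarith)
  have hM0 : (0 : ℝ) < M := hpos.trans hM
  have hM1 : 1 ≤ M := by exact_mod_cast hM0
  refine (iInf₂_le (3 + 2 / (M : ℝ))
    ⟨by positivity, TriangleAbsorber.isAchievable_three_add hM1⟩).trans ?_
  rw [EReal.coe_le_coe_iff]
  have : 2 / (M : ℝ) < z - 3 := by
    rw [div_lt_iff₀ hM0]
    rw [div_lt_iff₀ (by linarith)] at hM
    linarith
  linarith
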